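/- There are absolute constants $c,h,a,b>0$ such that for every $\alpha\in(0,1)$ there is a 3-regular bipartite graph $G=(L,R,E)$ on $n$ vertices, with $a\,(\alpha^2\log^2\alpha)^{-1}\le n\le b\,(\alpha^2\log^2\alpha)^{-1}$ and with edge expansion at least $h$ (every set $S$ of at most $n/2$ vertices has at least $h|S|$ edges of $G$ leaving it), for which the following holds. Consider the Correlation Clustering instance on the complete bipartite graph with parts $L,R$ in which the pairs in $E^+=E$ are positive edges of weight $\mathbf w_{uv}=1$ and the pairs in $E^-=(L\times R)\setminus E$ are negative edges of weight $\mathbf w_{uv}=\alpha$. It is an instance with asymmetric classification errors with parameter $\alpha$, that is, for some $\mathbf w>0$ all positive edges have weight in $[\alpha\mathbf w,\mathbf w]$ and all negative edges have weight at least $\alpha\mathbf w$. Let $\mathrm{OPT}$ be the minimum over all partitions of $L\cup R$ into clusters of the total weight of the positive edges between different clusters plus the total weight of the negative edges inside clusters. Let $\mathrm{LP}$ be the value of the natural linear programming relaxation: the minimum of $$\sum_{uv\in E^+}\mathbf w_{uv}x_{uv}+\sum_{uv\in E^-}\mathbf w_{uv}(1-x_{uv})$$ over all $x$ with $x_{uw}\le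 x_{uv}+x_{vw}$, $x_{uv}=x_{vu}$, $x_{uu}=0$ and $x_{uv}\in[0,1]$ for all $u,v,w\in L\cup R$. Then $\mathrm{LP}>0$ and the integrality gap satisfies $$\frac{\mathrm{OPT}}{\mathrm{LP}}\ \ge\ c\,\log\frac1\alpha .$$ -/

import Mathlib

/-- An instance of Correlation Clustering on the complete bipartite graph with parts `L` and `R`:
every pair `(l, r)` is an edge, it is positive if `pos l r` and negative otherwise, and
it has weight `weight l r`. -/
structure BipartiteCC (L R : Type*) where
  /-- the set `E⁺` of positive edges; every other pair in `L × R` is a negative edge -/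
  pos : L → R → Prop
  /-- the edge weights -/
  weight : L → R → ℝ

/-- Feasible solutions of the natural linear programming relaxation of Correlation Clustering
on the vertex set `V`: semimetrics with values in `[0, 1]`. -/
structure LPFeasible {V : Type*} (x : V → V → ℝ) : Prop where
  triangle : ∀ u v w, x u w ≤ x u v + x v w
  symm : ∀ u v, x u v = x v u
  self : ∀ u, x u u = 0
  mem_Icc : ∀ u v, x u v ∈ Set.Icc (0 : ℝ) 1

namespace BipartiteCC

/-- Asymmetric classification errors with parameter `α`: for some scale `w > 0`, the
positive weights lie in `[α w, w]` and the negative weights lie in `[α w, ∞)`. -/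
def IsAsymmetric {L R : Type*} (I : BipartiteCC L R) (α : ℝ) : Prop :=
  ∃ w : ℝ, 0 < w ∧
    (∀ l r, I.pos l r → I.weight l r ∈ Set.Icc (α * w) w) ∧
    (∀ l r, ¬ I.pos l r → α * w ≤ I.weight l r)

open Classical in
/-- The MinDisagree cost of a clustering of the vertices (the clusters are the classes of `s`):
the total weight of the positive edges between different clusters and of the negative edges inside
clusters. -/
noncomputable def clusterCost {L R : Type*} [Fintype L] [Fintype R] (I : BipartiteCC L R)
    (s : Setoid (L ⊕ R)) : ℝ :=
  ∑ l : L, ∑ r : R,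
    if I.pos l r then (if s (Sum.inl l) (Sum.inr r) then 0 else I.weight l r)
    else (if s (Sum.inl l) (Sum.inr r) then I.weight l r else 0)

open Classical in
/-- The linear programming objective. -/
noncomputable def lpCost {L R : Type*} [Fintype L] [Fintype R] (I : BipartiteCC L R)
    (x : L ⊕ R → L ⊕ R → ℝ) : ℝ :=
  ∑ l : L, ∑ r : R,
    if I.pos l r then I.weight l r * x (Sum.inl l) (Sum.inr r)
    else I.weight l r * (1 - x (Sum.inl l) (Sum.inr r))

/-- The cost of an optimal clustering (the infimum is over a finite nonempty set). -/
noncomputable def optValue {L R : Type*} [Fintype L] [Fintype R] (I : BipartiteCC L R) : ℝ :=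
  sInf (Set.range I.clusterCost)

/-- The value of the linear programming relaxation (the infimum is over a nonempty bounded set). -/
noncomputable def lpValue {L R : Type*} [Fintype L] [Fintype R] (I : BipartiteCC L R) : ℝ :=
  sInf (I.lpCost '' {x | LPFeasible x})

/-- The integrality gap of an instance, for instances with `0 < lpValue`. -/
noncomputable def integralityGap {L R : Type*} [Fintype L] [Fintype R]
    (I : BipartiteCC L R) : ℝ :=
  I.optValue / I.lpValue

open Classical in
/-- The instance of a bipartite graph `G` with parts `L` and `R`: edges of `G` are positive with
weight `1`, the other pairs in `L × R` are negative with weight `α`. -/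
noncomputable def ofGraph {L R : Type*} (G : SimpleGraph (L ⊕ R)) (α : ℝ) : BipartiteCC L R where
  pos l r := G.Adj (Sum.inl l) (Sum.inr r)
  weight l r := if G.Adj (Sum.inl l) (Sum.inr r) then 1 else α

end BipartiteCC

open Classical in
/-- `G` has edge expansion at least `h`: every set `S` of at most half of the vertices has at least
`h * |S|` edges leaving it. -/
def HasEdgeExpansion {V : Type*} [Fintype V] (G : SimpleGraph V) (h : ℝ) : Prop :=
  ∀ S : Finset V, 2 * S.card ≤ Fintype.card V → h * S.card ≤ (G.interedges S Sᶜ).card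

open Classical in
/-- A `3`-regular bipartite graph with parts `L` and `R` and edge expansion at least `h`. -/
structure IsCubicBipartiteExpander {L R : Type*} [Fintype L] [Fintype R]
    (G : SimpleGraph (L ⊕ R)) (h : ℝ) : Prop where
  bipartite : G ≤ completeBipartiteGraph L R
  regular : G.IsRegularOfDegree 3
  expansion : HasEdgeExpansion G h

/-! Let G be a cubic bipartite expander with m vertices on each side, where α·m ≥ 1. Sparse cuts do
not exist in G, yet its shortest-path metric is spread out, and this separates OPT from LP.

OPT is at least (h/4)·m (`BipartiteCC.le_ofGraph_clusterCost`). If every cluster has at most m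
vertices, expansion of the clusters cuts linearly many positive edges. Otherwise one cluster is a
giant; either expansion of its complement already cuts enough, or the giant contains half of each
side and so about m²/4 negative pairs, of weight at least of order α·m² ≥ m.

LP is at most m·(3/D + α·4^D) (`BipartiteCC.ofGraph_lpValue_le`): take x = min(1, dist/D). A
positive edge costs 1/D, and a negative pair costs something only within distance D, where bounded
degree leaves at most 4^D vertices. Choosing D of order log(1/α) gives LP = O(m / log(1/α))
(`exists_depth`).

The expander comes from the probabilistic method. Five random permutations of k points expand
(`exists_perm_expansion`); replacing every point by a 10-cycle makes the graph cubic and loses only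
a constant factor (`replacementGraph_hasEdgeExpansion`). -/

/-! ### Binomial coefficient estimates -/

theorem choose_le_choose_of_le_half {k r s : ℕ} (hrs : r ≤ s) (hsk : 2 * s ≤ k) :
    k.choose r ≤ k.choose s := by
  induction s, hrs using Nat.le_induction with
  | base => rfl
  | succ n hn ih =>
    exact (ih (by omega)).trans (Nat.choose_le_succ_of_lt_half_left (by omega))

theorem le_choose_of_le_half {k s : ℕ} (hs : 1 ≤ s) (hsk : 2 * s ≤ k) : k ≤ k.choose s := by
  simpa using choose_le_choose_of_le_half hs hsk

theorem choose_sq_le_choose {k s t : ℕ} (hts : 100 * t ≤ s) (hsk : 2 * s ≤ k) :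
    k.choose t ^ 2 ≤ k.choose s := by
  rcases Nat.eq_zero_or_pos t with rfl | ht
  · have := Nat.choose_pos (by omega : s ≤ k)
    rw [Nat.choose_zero_right]
    omega
  -- It suffices to compare with 4t in place of s: C(k,t) ≤ (3k/t)^t and C(k,4t) ≥ (k/8t)^(4t),
  -- while 3k/t ≤ (k/8t)² amounts to 192t ≤ k.
  refine le_trans ?_ (choose_le_choose_of_le_half (by omega : 4 * t ≤ s) hsk)
  have ht' : (0 : ℝ) < t := by exact_mod_cast ht
  have hk : (200 : ℝ) * t ≤ k := by exact_mod_cast (by omega : 200 * t ≤ k)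
  have h1 : (k.choose t : ℝ) ≤ (3 * k / t) ^ t := by
    have h2 := Nat.choose_le_pow_div (α := ℝ) t k
    have h3 : (t : ℝ) ^ t / t.factorial ≤ 3 ^ t := by
      refine (Real.pow_div_factorial_le_exp (t : ℝ) ht'.le t).trans ?_
      have : Real.exp (t : ℝ) = Real.exp 1 ^ t := by rw [← Real.exp_nat_mul]; simp
      rw [this]
      have := Real.exp_one_lt_d9
      gcongr
      linarith
    have hf : (0 : ℝ) < t.factorial := by positivity
    refine h2.trans ?_
    rw [div_pow, mul_pow, div_le_div_iff₀ hf (by positivity)]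
    rw [div_le_iff₀ hf] at h3
    nlinarith [pow_nonneg (by positivity : (0 : ℝ) ≤ k) t]
  have h4 : ((k : ℝ) / (8 * t)) ^ (4 * t) ≤ k.choose (4 * t) := by
    have h5 := Nat.pow_le_choose (α := ℝ) (4 * t) k
    have h6 : ((4 * t).factorial : ℝ) ≤ (4 * t) ^ (4 * t) := by
      exact_mod_cast Nat.factorial_le_pow (4 * t)
    have h7 : (k : ℝ) / 2 ≤ ((k + 1 - 4 * t : ℕ) : ℝ) := by
      rw [Nat.cast_sub (by omega)]; push_cast; linarith
    rw [div_le_iff₀ (by positivity)] at h5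
    have h8 : ((k : ℝ) / 2) ^ (4 * t) ≤ k.choose (4 * t) * (4 * t) ^ (4 * t) := by
      calc ((k : ℝ) / 2) ^ (4 * t) ≤ ((k + 1 - 4 * t : ℕ) : ℝ) ^ (4 * t) := by gcongr
        _ ≤ _ := h5
        _ ≤ _ := by gcongr
    have h9 : (k : ℝ) / (8 * t) = (k / 2) / (4 * t) := by rw [div_div]; ring_nf
    rw [h9, div_pow, div_le_iff₀ (by positivity)]
    exact h8
  have h10 : (3 * (k : ℝ) / t) ≤ (k / (8 * t)) ^ 2 := by
    rw [div_pow, div_le_div_iff₀ ht' (by positivity)]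
    nlinarith [mul_nonneg (mul_nonneg (by positivity : (0 : ℝ) ≤ k) ht'.le) (sub_nonneg.2 hk)]
  have : (k.choose t : ℝ) ^ 2 ≤ k.choose (4 * t) := by
    refine le_trans ?_ h4
    have e1 : ((k : ℝ) / (8 * t)) ^ (4 * t) = ((((k : ℝ) / (8 * t)) ^ 2) ^ t) ^ 2 := by
      rw [← pow_mul, ← pow_mul]; congr 1; ring
    rw [e1]
    gcongr
    exact h1.trans (by gcongr)
  exact_mod_cast this

/-! ### Expanding families of permutations -/

open Finset in
theorem card_perm_image_eq {V : Type*} [Fintype V] [DecidableEq V] (F W : Finset V)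
    (h : #F = #W) :
    #{π : Equiv.Perm V | F.image π = W} = #{π : Equiv.Perm V | F.image π = F} := by
  obtain ⟨e⟩ : Nonempty ({x // x ∈ F} ≃ {x // x ∈ W}) := Fintype.card_eq.1 (by simpa using h)
  let g : Equiv.Perm V := e.extendSubtype
  have hg : F.image g = W := by
    refine eq_of_subset_of_card_le ?_ ?_
    · intro y hy
      obtain ⟨x, hx, rfl⟩ := mem_image.1 hy
      exact e.extendSubtype_mem x hx
    · rw [card_image_of_injective _ g.injective, h]
  refine (card_bij (fun π _ => g * π) ?_ ?_ ?_).symm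
  · intro π hπ
    simp only [mem_filter, mem_univ, true_and] at hπ ⊢
    rw [← hg]
    nth_rewrite 2 [← hπ]
    rw [image_image]
    rfl
  · intro π _ π' _ h
    exact mul_left_cancel h
  · intro π hπ
    refine ⟨g⁻¹ * π, ?_, by simp⟩
    simp only [mem_filter, mem_univ, true_and] at hπ ⊢
    have : F.image (g⁻¹ * π : Equiv.Perm V) = (F.image π).image (g⁻¹ : Equiv.Perm V) := by
      rw [image_image]; rfl
    rw [this, hπ, ← hg, image_image]
    ext x
    simp

-- The image of F under a uniformly random permutation is a uniformly random set of size |F|; this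
-- is the resulting probability bound with denominators cleared.
open Finset in
theorem card_perm_image_subset_mul_choose_le {V : Type*} [Fintype V] [DecidableEq V]
    (F U : Finset V) :
    #{π : Equiv.Perm V | F.image π ⊆ U} * (Fintype.card V).choose #F ≤
      (#U).choose #F * Fintype.card (Equiv.Perm V) := by
  have h1 : Fintype.card (Equiv.Perm V) =
      (Fintype.card V).choose #F * #{π : Equiv.Perm V | F.image π = F} := by
    rw [← card_univ, card_eq_sum_card_fiberwise (f := fun π : Equiv.Perm V => F.image π)
      (t := powersetCard #F univ)]
    · rw [sum_congr rfl (fun W hW => card_perm_image_eq F W (mem_powersetCard.1 hW).2.symm)]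
      simp
    · intro π _
      simp [mem_powersetCard, card_image_of_injective _ π.injective]
  have h2 : #{π : Equiv.Perm V | F.image π ⊆ U} ≤
      (#U).choose #F * #{π : Equiv.Perm V | F.image π = F} := by
    rw [card_eq_sum_card_fiberwise (f := fun π : Equiv.Perm V => F.image π)
      (t := powersetCard #F U)]
    · rw [← card_powersetCard, ← smul_eq_mul, ← sum_const]
      refine sum_le_sum fun W hW => ?_
      rw [← card_perm_image_eq F W (mem_powersetCard.1 hW).2.symm]
      exact card_le_card fun π hπ => by
        simp only [mem_filter, mem_univ, true_and] at hπ ⊢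
        exact hπ.2
    · intro π hπ
      simp only [coe_filter, mem_univ, true_and, Set.mem_ofPred_eq] at hπ
      simp [mem_powersetCard, card_image_of_injective _ π.injective, hπ]
  calc _ ≤ (#U).choose #F * #{π : Equiv.Perm V | F.image π = F} *
        (Fintype.card V).choose #F := by gcongr
    _ = _ := by rw [h1]; ring

-- First-moment argument. If F fails to expand, the few points reached outside F lie in one small
-- set T, so all five permutations map F into F ∪ T. A union bound over F and T leaves total
-- probability below 1.
open Finset in
theorem exists_perm_expansion (k : ℕ) :
    ∃ π : Fin 5 → Equiv.Perm (Fin k), ∀ F : Finset (Fin k), 2 * #F ≤ k →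
      #F ≤ 100 * #{p ∈ F ×ˢ (univ : Finset (Fin 5)) | π p.2 p.1 ∉ F} := by
  by_contra! hbad
  let P := Equiv.Perm (Fin k)
  let N : Finset (Fin k) → Finset (Fin k) → ℕ := fun F U => #{π : P | F.image π ⊆ U}
  let B : Finset (Fin k) → Finset (Fin k) → Finset (Fin 5 → P) := fun F T =>
    Fintype.piFinset fun _ => {π : P | F.image π ⊆ F ∪ T}
  let 𝓕 : Finset (Finset (Fin k)) := {F | 1 ≤ #F ∧ 2 * #F ≤ k}
  have hcover : (univ : Finset (Fin 5 → P)) ⊆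
      𝓕.biUnion fun F => (powersetCard (#F / 100) univ).biUnion fun T => B F T := by
    intro π _
    obtain ⟨F, hF, hlt⟩ := hbad π
    set E := {p ∈ F ×ˢ (univ : Finset (Fin 5)) | π p.2 p.1 ∉ F} with hE
    -- The same T serves all five permutations; padding it to size exactly ⌊|F|/100⌋ makes the
    -- number of choices a single binomial coefficient.
    have hcard : #(E.image fun p => π p.2 p.1) ≤ #F / 100 :=
      card_image_le.trans (by omega)
    obtain ⟨T, hT, hTc⟩ := exists_superset_card_eq hcard
      (by rw [Fintype.card_fin]; omega)
    simp only [mem_biUnion]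
    refine ⟨F, mem_filter.2 ⟨mem_univ _, by omega, hF⟩, T, by simp [mem_powersetCard, hTc], ?_⟩
    simp only [B, Fintype.mem_piFinset, mem_filter, mem_univ, true_and]
    intro i y hy
    obtain ⟨x, hx, rfl⟩ := mem_image.1 hy
    rw [mem_union]
    by_cases hm : π i x ∈ F
    · exact Or.inl hm
    · exact Or.inr (hT (mem_image.2 ⟨(x, i), by simp [hE, hx, hm], rfl⟩))
  have hP : (0 : ℝ) < Fintype.card P := by exact_mod_cast Fintype.card_pos
  have hterm : ∀ F ∈ 𝓕, ∀ T ∈ powersetCard (#F / 100) (univ : Finset (Fin k)),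
      (#(B F T) : ℝ) ≤ ((Fintype.card P : ℝ) * k.choose (#F / 100) / k.choose #F) ^ 5 := by
    intro F hF T hT
    simp only [𝓕, mem_filter, mem_univ, true_and] at hF
    have hTc := (mem_powersetCard.1 hT).2
    have hpos : (0 : ℝ) < k.choose #F := by
      exact_mod_cast Nat.choose_pos (by omega)
    have h1 : #(B F T) = N F (F ∪ T) ^ 5 := by
      simp [B, N, Fintype.card_piFinset]
    have h2 := card_perm_image_subset_mul_choose_le F (F ∪ T)
    have h3 : (#(F ∪ T)).choose #F ≤ k.choose (#F / 100) := by
      have hU : #(F ∪ T) ≤ #F + #F / 100 := (card_union_le _ _).trans (by omega)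
      calc (#(F ∪ T)).choose #F ≤ (#F + #F / 100).choose #F := Nat.choose_le_choose _ hU
        _ = (#F + #F / 100).choose (#F / 100) := Nat.choose_symm_add
        _ ≤ _ := Nat.choose_le_choose _ (by omega)
    rw [h1]
    push_cast
    gcongr
    rw [le_div_iff₀ hpos]
    rw [Fintype.card_fin] at h2
    have h4 : N F (F ∪ T) * k.choose #F ≤ Fintype.card P * k.choose (#F / 100) :=
      h2.trans (by rw [mul_comm]; gcongr)
    exact_mod_cast h4
  have hsum : ∀ F ∈ 𝓕, (#((powersetCard (#F / 100) univ).biUnion fun T => B F T) : ℝ) ≤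
      (Fintype.card P : ℝ) ^ 5 * ((k : ℝ)⁻¹ * (k.choose #F : ℝ)⁻¹) := by
    intro F hF
    have hF' := hF
    simp only [𝓕, mem_filter, mem_univ, true_and] at hF'
    have hk : (0 : ℝ) < k := by exact_mod_cast (by omega : 0 < k)
    have h1 : (#((powersetCard (#F / 100) univ).biUnion fun T => B F T) : ℝ) ≤
        ∑ T ∈ powersetCard (#F / 100) (univ : Finset (Fin k)), (#(B F T) : ℝ) := by
      exact_mod_cast card_biUnion_le
    refine h1.trans ((sum_le_sum (hterm F hF)).trans ?_)
    rw [sum_const, card_powersetCard, card_univ, Fintype.card_fin, nsmul_eq_mul]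
    have hx : ((k.choose (#F / 100) : ℝ)) ^ 2 ≤ k.choose #F := by
      exact_mod_cast choose_sq_le_choose (Nat.mul_div_le _ _) hF'.2
    have hy : (k : ℝ) ≤ k.choose #F := by
      exact_mod_cast le_choose_of_le_half hF'.1 hF'.2
    set x : ℝ := ((k.choose (#F / 100) : ℕ) : ℝ)
    set y : ℝ := ((k.choose #F : ℕ) : ℝ)
    have hy0 : 0 < y := hk.trans_le hy
    have hx6 : x ^ 6 ≤ y ^ 3 := by
      calc x ^ 6 = (x ^ 2) ^ 3 := by ring
        _ ≤ y ^ 3 := by gcongr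
    -- This is where five permutations are needed: x choices of T times (x/y)^5 is x⁶/y⁵ ≤ y⁻². One
    -- factor 1/y pays for the choices of F of a given size, the other, at most 1/k, for the fewer
    -- than k sizes.
    have : x * (Fintype.card P * x / y) ^ 5 = Fintype.card P ^ 5 * (x ^ 6 / y ^ 5) := by
      field_simp
    rw [this]
    gcongr
    rw [← mul_inv, ← one_div, div_le_div_iff₀ (by positivity) (by positivity)]
    calc x ^ 6 * (k * y) ≤ y ^ 3 * (y * y) := by gcongr
      _ = 1 * y ^ 5 := by ring
  have hcount : ∑ F ∈ 𝓕, ((k : ℝ)⁻¹ * (k.choose #F : ℝ)⁻¹) < 1 := by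
    have hmaps : ∀ F ∈ 𝓕, #F ∈ Icc 1 (k / 2) := by
      intro F hF
      simp only [𝓕, mem_filter, mem_univ, true_and] at hF
      rw [mem_Icc]; omega
    rw [← sum_fiberwise_of_maps_to hmaps]
    have h1 : ∀ s ∈ Icc 1 (k / 2), ∑ F ∈ 𝓕 with #F = s, ((k : ℝ)⁻¹ * (k.choose #F : ℝ)⁻¹)
        ≤ (k : ℝ)⁻¹ := by
      intro s hs
      rw [mem_Icc] at hs
      have hsub : {F ∈ 𝓕 | #F = s} ⊆ powersetCard s univ := by
        intro F hF
        simp [mem_powersetCard, (mem_filter.1 hF).2]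
      have hc : (#{F ∈ 𝓕 | #F = s} : ℝ) ≤ k.choose s := by
        have := card_le_card hsub
        rw [card_powersetCard, card_univ, Fintype.card_fin] at this
        exact_mod_cast this
      have hpos : (0 : ℝ) < k.choose s := by exact_mod_cast Nat.choose_pos (by omega)
      rw [sum_congr rfl (g := fun _ => (k : ℝ)⁻¹ * (k.choose s : ℝ)⁻¹)
        (fun F hF => by rw [(mem_filter.1 hF).2]), sum_const, nsmul_eq_mul]
      calc _ ≤ (k.choose s : ℝ) * ((k : ℝ)⁻¹ * (k.choose s : ℝ)⁻¹) := by gcongr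
        _ = _ := by field_simp
    refine (sum_le_sum h1).trans_lt ?_
    rw [sum_const, Nat.card_Icc, nsmul_eq_mul, Nat.add_sub_cancel]
    rcases Nat.eq_zero_or_pos k with rfl | hk
    · simp
    · rw [← div_eq_mul_inv, div_lt_one (by exact_mod_cast hk)]
      exact_mod_cast Nat.div_lt_self hk (by norm_num)
  have htotal : (Fintype.card P : ℝ) ^ 5 ≤
      (Fintype.card P : ℝ) ^ 5 * ∑ F ∈ 𝓕, ((k : ℝ)⁻¹ * (k.choose #F : ℝ)⁻¹) := by
    have h1 := (card_le_card hcover).trans card_biUnion_le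
    rw [card_univ, Fintype.card_fun, Fintype.card_fin] at h1
    rw [mul_sum]
    refine le_trans ?_ (sum_le_sum hsum)
    exact_mod_cast h1
  have := mul_lt_mul_of_pos_left hcount (pow_pos hP 5)
  linarith

/-! ### Cubic bipartite expanders by cycle replacement -/

/-- The bipartite graph on two copies of `W` in which `a` on the left is joined to the images of `a`
under a family of permutations on the right. -/
def permGraph {W ι : Type*} (σ : ι → Equiv.Perm W) : SimpleGraph (W ⊕ W) where
  Adj
    | Sum.inl a, Sum.inr b => ∃ i, σ i a = b
    | Sum.inr b, Sum.inl a => ∃ i, σ i a = b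
    | _, _ => False
  symm := ⟨by rintro (a | a) (b | b) h <;> exact h⟩
  loopless := ⟨by rintro (a | a) h <;> exact h⟩

section permGraph

variable {W ι : Type*} (σ : ι → Equiv.Perm W)

@[simp] theorem permGraph_adj_inl_inr (a b : W) :
    (permGraph σ).Adj (Sum.inl a) (Sum.inr b) ↔ ∃ i, σ i a = b := Iff.rfl

@[simp] theorem permGraph_adj_inr_inl (a b : W) :
    (permGraph σ).Adj (Sum.inr b) (Sum.inl a) ↔ ∃ i, σ i a = b := Iff.rfl

@[simp] theorem permGraph_adj_inl_inl (a b : W) :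
    ¬ (permGraph σ).Adj (Sum.inl a) (Sum.inl b) := id

@[simp] theorem permGraph_adj_inr_inr (a b : W) :
    ¬ (permGraph σ).Adj (Sum.inr a) (Sum.inr b) := id

theorem permGraph_le_completeBipartiteGraph : permGraph σ ≤ completeBipartiteGraph W W := by
  rintro (a | a) (b | b) h <;> simp_all

theorem permGraph_isRegularOfDegree [Fintype ι] (hσ : ∀ a, Function.Injective fun i => σ i a)
    {G : SimpleGraph (W ⊕ W)} [G.LocallyFinite] (hG : G = permGraph σ) :
    G.IsRegularOfDegree (Fintype.card ι) := by
  classical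
  subst hG
  rintro (a | b)
  · have : (permGraph σ).neighborFinset (Sum.inl a) =
        Finset.univ.image fun i => Sum.inr (σ i a) := by
      ext (c | c) <;> simp
    rw [← SimpleGraph.card_neighborFinset_eq_degree, this,
      Finset.card_image_of_injective _ fun i j h => hσ a (Sum.inr_injective h), Finset.card_univ]
  · have : (permGraph σ).neighborFinset (Sum.inr b) =
        Finset.univ.image fun i => Sum.inl ((σ i).symm b) := by
      ext (c | c)
      · simp [Equiv.eq_symm_apply, eq_comm]
      · simp
    rw [← SimpleGraph.card_neighborFinset_eq_degree, this, Finset.card_image_of_injective,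
      Finset.card_univ]
    intro i j h
    have h' : (σ i).symm b = (σ j).symm b := Sum.inl_injective h
    refine hσ ((σ i).symm b) ?_
    change σ i ((σ i).symm b) = σ j ((σ i).symm b)
    rw [h', Equiv.apply_symm_apply, ← h', Equiv.apply_symm_apply]

end permGraph

/-- The three permutations of `V × Fin 5` whose graph arises from the graph of the permutations `π`
of `V` by replacing each vertex with a cycle of length ten. -/
def cycleReplacement {V : Type*} (π : Fin 5 → Equiv.Perm V) : Fin 3 → Equiv.Perm (V × Fin 5) :=
  ![Equiv.refl _,
    (Equiv.refl V).prodCongr (Equiv.addRight 1),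
    { toFun := fun p => (π p.2 p.1, p.2 + 2)
      invFun := fun p => ((π (p.2 - 2)).symm p.1, p.2 - 2)
      left_inv := fun p => by simp
      right_inv := fun p => by simp }]

/-- The three permutations shift the `Fin 5` coordinate by 0, 1 and 2, so no edge is repeated and
the degree is exactly 3. -/
theorem cycleReplacement_injective {V : Type*} (π : Fin 5 → Equiv.Perm V) (p : V × Fin 5) :
    Function.Injective fun j => cycleReplacement π j p := by
  have h : ∀ j, (cycleReplacement π j p).2 = p.2 + (j.castLE (by norm_num) : Fin 5) := by
    intro j
    fin_cases j <;> simp [cycleReplacement]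
  intro i j hij
  have := congrArg Prod.snd hij
  simp only [h] at this
  exact Fin.castLE_injective _ (add_left_cancel this)

section replacementGraph

variable {V W : Type*} (e : W ≃ V × Fin 5) (π : Fin 5 → Equiv.Perm V)

/-- The cubic bipartite graph obtained from the graph of five permutations of `V` by replacing each
vertex with a cycle of length ten; `e` labels the vertices on each side. -/
def replacementGraph : SimpleGraph (W ⊕ W) :=
  permGraph fun j => e.symm.permCongr (cycleReplacement π j)

theorem replacementGraph_adj_self (v : V) (i : Fin 5) :
    (replacementGraph e π).Adj (Sum.inl (e.symm (v, i))) (Sum.inr (e.symm (v, i))) :=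
  ⟨0, by simp [cycleReplacement]⟩

theorem replacementGraph_adj_succ (v : V) (i : Fin 5) :
    (replacementGraph e π).Adj (Sum.inl (e.symm (v, i))) (Sum.inr (e.symm (v, i + 1))) :=
  ⟨1, by simp [cycleReplacement, Equiv.permCongr_apply]⟩

theorem replacementGraph_adj_perm (v : V) (i : Fin 5) :
    (replacementGraph e π).Adj (Sum.inl (e.symm (v, i))) (Sum.inr (e.symm (π i v, i + 2))) :=
  ⟨2, by simp [cycleReplacement, Equiv.permCongr_apply]⟩

theorem replacementGraph_isRegularOfDegree [(replacementGraph e π).LocallyFinite] :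
    (replacementGraph e π).IsRegularOfDegree 3 :=
  permGraph_isRegularOfDegree (fun j => e.symm.permCongr (cycleReplacement π j)) (fun a i j h =>
    cycleReplacement_injective π (e a) (by simpa [Equiv.permCongr_apply] using h)) rfl

-- Let F and M be the 10-cycles wholly, respectively partly, inside S, and D the edges leaving S. A
-- cycle in M is connected, so it contributes its own edge to D, giving |M| ≤ |D|. A permutation
-- edge escaping from F either leaves S or ends in M, and at most 5|M| do the latter. Hence |F| ≤
-- 100(|D| + 5|M|) ≤ 600|D| and |S| ≤ 10(|F| + |M|) ≤ 6010|D|.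
open Finset in
theorem replacementGraph_hasEdgeExpansion [Fintype V] [DecidableEq V] [Fintype W]
    (hπ : ∀ F : Finset V, 2 * #F ≤ Fintype.card V →
      #F ≤ 100 * #{p ∈ F ×ˢ (univ : Finset (Fin 5)) | π p.2 p.1 ∉ F}) :
    HasEdgeExpansion (replacementGraph e π) (1 / 6010) := by
  classical
  intro S hS
  set D := (replacementGraph e π).interedges S Sᶜ with hD
  have hmem : ∀ u v, (u, v) ∈ D ↔ u ∈ S ∧ v ∉ S ∧ (replacementGraph e π).Adj u v := by
    intro u v; simp [hD, SimpleGraph.mem_interedges_iff]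
  let κ : W ⊕ W → V × Fin 5 := Sum.elim e e
  let F : Finset V :=
    {v | ∀ i, Sum.inl (e.symm (v, i)) ∈ S ∧ Sum.inr (e.symm (v, i)) ∈ S}
  let M : Finset V :=
    {v | (∃ i, Sum.inl (e.symm (v, i)) ∈ S ∨ Sum.inr (e.symm (v, i)) ∈ S) ∧ v ∉ F}
  have hF : ∀ v, v ∈ F ↔ ∀ i, Sum.inl (e.symm (v, i)) ∈ S ∧ Sum.inr (e.symm (v, i)) ∈ S := by
    intro v; simp [F]
  have hM : ∀ v, v ∈ M ↔
      (∃ i, Sum.inl (e.symm (v, i)) ∈ S ∨ Sum.inr (e.symm (v, i)) ∈ S) ∧ v ∉ F := by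
    intro v; simp [M]
  let 𝓛 : Finset V → Finset (W ⊕ W) := fun A =>
    ((A ×ˢ univ).disjSum (A ×ˢ univ)).map (Equiv.sumCongr e.symm e.symm).toEmbedding
  have h𝓛 : ∀ A, #(𝓛 A) = 10 * #A := by
    intro A; simp [𝓛]; ring
  have hFS : 10 * #F ≤ #S := by
    rw [← h𝓛]
    refine card_le_card fun u hu => ?_
    simp only [𝓛, mem_map_equiv, mem_disjSum, mem_product, mem_univ, and_true] at hu
    rcases u with a | a <;> simp [hF] at hu
    · simpa using (hu (e a).2).1
    · simpa using (hu (e a).2).2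
  have hSM : #S ≤ 10 * (#F + #M) := by
    calc #S ≤ #(𝓛 (F ∪ M)) := ?_
      _ = 10 * #(F ∪ M) := h𝓛 _
      _ ≤ _ := by gcongr; exact card_union_le _ _
    refine card_le_card fun u hu => ?_
    have key : ∀ v, (∃ i, Sum.inl (e.symm (v, i)) ∈ S ∨ Sum.inr (e.symm (v, i)) ∈ S) →
        v ∈ F ∪ M := by
      intro v hv
      rw [mem_union, hM]
      by_cases h : v ∈ F
      · exact Or.inl h
      · exact Or.inr ⟨hv, h⟩
    simp only [𝓛, mem_map_equiv, mem_disjSum, mem_product, mem_univ, and_true]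
    rcases u with a | a
    · exact Or.inl ⟨e a, key _ ⟨(e a).2, Or.inl (by simpa using hu)⟩, rfl⟩
    · exact Or.inr ⟨e a, key _ ⟨(e a).2, Or.inr (by simpa using hu)⟩, rfl⟩
  have hMD : #M ≤ #D := by
    refine le_trans (card_le_card ?_) (card_image_le (s := D) (f := fun p => (κ p.1).1))
    intro v hv
    rw [hM] at hv
    by_contra hno
    have hno' : ∀ u w, (κ u).1 = v → (replacementGraph e π).Adj u w → u ∈ S → w ∈ S := by
      intro u w hu hadj huS
      by_contra hw
      exact hno (mem_image.2 ⟨(u, w), (hmem u w).2 ⟨huS, hw, hadj⟩, hu⟩)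
    have h1 : ∀ i, Sum.inl (e.symm (v, i)) ∈ S ↔ Sum.inr (e.symm (v, i)) ∈ S := fun i =>
      ⟨hno' _ _ (by simp [κ]) (replacementGraph_adj_self e π v i),
        hno' _ _ (by simp [κ]) (replacementGraph_adj_self e π v i).symm⟩
    have h2 : ∀ i, Sum.inl (e.symm (v, i)) ∈ S ↔ Sum.inr (e.symm (v, i + 1)) ∈ S := fun i =>
      ⟨hno' _ _ (by simp [κ]) (replacementGraph_adj_succ e π v i),
        hno' _ _ (by simp [κ]) (replacementGraph_adj_succ e π v i).symm⟩
    have h3 : ∀ i, Sum.inl (e.symm (v, i)) ∈ S ↔ Sum.inl (e.symm (v, 0)) ∈ S := by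
      have h4 : ∀ i, Sum.inl (e.symm (v, i + 1)) ∈ S ↔ Sum.inl (e.symm (v, i)) ∈ S := fun i => by
        rw [h1, h2]
      intro i
      induction i using Fin.induction with
      | zero => rfl
      | succ i ih => rw [← Fin.coeSucc_eq_succ, h4, ih]
    refine hv.2 ((hF v).2 fun i => ?_)
    obtain ⟨j, hj⟩ := hv.1
    rw [← h1, or_self, h3] at hj
    rw [← h1, and_self, h3]
    exact hj
  have hE0 : #{p ∈ F ×ˢ (univ : Finset (Fin 5)) | π p.2 p.1 ∉ F ∪ M} ≤ #D := by
    refine le_trans (card_le_card ?_) (card_image_le (s := D) (f := fun p => κ p.1))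
    rintro ⟨v, i⟩ hp
    simp only [mem_filter, mem_product, mem_univ, and_true, mem_union, hM, not_or] at hp
    refine mem_image.2 ⟨(Sum.inl (e.symm (v, i)), Sum.inr (e.symm (π i v, i + 2))),
      (hmem _ _).2 ⟨((hF v).1 hp.1 i).1, ?_, replacementGraph_adj_perm e π v i⟩, by simp [κ]⟩
    intro hmemS
    exact hp.2.2 ⟨⟨i + 2, Or.inr hmemS⟩, hp.2.1⟩
  have hE : #{p ∈ F ×ˢ (univ : Finset (Fin 5)) | π p.2 p.1 ∉ F} ≤ #D + 5 * #M := by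
    have hsub : {p ∈ F ×ˢ (univ : Finset (Fin 5)) | π p.2 p.1 ∉ F} ⊆
        {p ∈ F ×ˢ (univ : Finset (Fin 5)) | π p.2 p.1 ∉ F ∪ M} ∪
          (M ×ˢ (univ : Finset (Fin 5))).image fun p => ((π p.2).symm p.1, p.2) := by
      rintro ⟨v, i⟩ hp
      simp only [mem_filter, mem_product, mem_univ, and_true] at hp
      rw [mem_union]
      by_cases h : π i v ∈ M
      · exact Or.inr (mem_image.2 ⟨(π i v, i), by simp [h], by simp⟩)
      · exact Or.inl (by simp [hp, h])
    refine (card_le_card hsub).trans ((card_union_le _ _).trans (add_le_add hE0 ?_))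
    refine card_image_le.trans ?_
    simp [mul_comm]
  have hcard : Fintype.card (W ⊕ W) = 10 * Fintype.card V := by
    simp [Fintype.card_congr e]; ring
  have hfin := hπ F (by omega)
  have : #S ≤ 6010 * #D := by omega
  have : (#S : ℝ) ≤ 6010 * #D := by exact_mod_cast this
  have goal : (1 / 6010 : ℝ) * #S ≤ #D := by linarith
  convert goal

end replacementGraph

theorem exists_isCubicBipartiteExpander {k m : ℕ} (hm : m = k * 5) :
    ∃ G : SimpleGraph (Fin m ⊕ Fin m), IsCubicBipartiteExpander G (1 / 6010) := by
  obtain ⟨π, hπ⟩ := exists_perm_expansion k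
  subst hm
  classical
  refine ⟨replacementGraph finProdFinEquiv.symm π, permGraph_le_completeBipartiteGraph _,
    ?_, replacementGraph_hasEdgeExpansion _ _ ?_⟩
  · convert replacementGraph_isRegularOfDegree finProdFinEquiv.symm π
  simpa using hπ

/-! ### Connectivity, path lengths and ball sizes -/

theorem HasEdgeExpansion.connected {V : Type*} [Fintype V] [Nonempty V] {G : SimpleGraph V} {h : ℝ}
    (hh : 0 < h) (hG : HasEdgeExpansion G h) : G.Connected := by
  classical
  have key : ∀ S : Finset V, 2 * S.card ≤ Fintype.card V →
      (∀ u v, G.Adj u v → u ∈ S → v ∈ S) → S = ∅ := by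
    intro S hS hclosed
    have h1 := hG S hS
    have h2 : (G.interedges S Sᶜ) = ∅ := by
      refine Finset.eq_empty_of_forall_notMem fun p hp => ?_
      rw [SimpleGraph.mem_interedges_iff, Finset.mem_compl] at hp
      exact hp.2.1 (hclosed _ _ hp.2.2 hp.1)
    have h3 : (S.card : ℝ) ≤ 0 := by
      have : h * S.card ≤ 0 := by
        refine h1.trans (le_of_eq ?_)
        rw [← Nat.cast_zero, ← Finset.card_empty (α := V × V), ← h2]
      exact nonpos_of_mul_nonpos_right this hh
    rw [← Finset.card_eq_zero]
    exact_mod_cast le_antisymm h3 (by positivity)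
  refine { preconnected := fun u v => ?_ }
  let S : Finset V := {w | G.Reachable u w}
  have hu : u ∈ S := by simp [S]
  have hS : ∀ w w', G.Adj w w' → (w ∈ S ↔ w' ∈ S) := by
    intro w w' hw
    simp only [S, Finset.mem_filter, Finset.mem_univ, true_and]
    exact ⟨fun h => h.trans hw.reachable, fun h => h.trans hw.reachable.symm⟩
  have hc : Sᶜ = ∅ := by
    by_cases hle : 2 * S.card ≤ Fintype.card V
    · rw [key S hle fun w w' hw => (hS w w' hw).1] at hu
      simp at hu
    · refine key Sᶜ ?_ fun w w' hw => ?_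
      · rw [Finset.card_compl]; omega
      · rw [Finset.mem_compl, Finset.mem_compl, hS w w' hw]
        exact id
  have hv : v ∈ S := by
    rw [Finset.compl_eq_empty_iff] at hc
    rw [hc]; exact Finset.mem_univ v
  simpa [S] using hv

theorem LPFeasible.le_length_mul {V : Type*} {x : V → V → ℝ} (hx : LPFeasible x)
    {G : SimpleGraph V} {A : ℝ} (hA : ∀ u v, G.Adj u v → x u v ≤ A) {u v : V} (p : G.Walk u v) :
    x u v ≤ p.length * A := by
  induction p with
  | nil => simp [hx.self]
  | @cons a b c hab p ih =>
    have := hx.triangle a b c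
    have := hA a b hab
    rw [SimpleGraph.Walk.length_cons]
    push_cast
    linarith

open Finset in
theorem SimpleGraph.card_walk_length_le {V : Type*} [Fintype V] [DecidableEq V] (G : SimpleGraph V)
    [G.LocallyFinite] (hd : ∀ v, G.degree v ≤ 3) (n : ℕ) (u : V)
    [DecidablePred fun v => ∃ p : G.Walk u v, p.length ≤ n] :
    #{v | ∃ p : G.Walk u v, p.length ≤ n} ≤ 4 ^ n := by
  classical
  induction n generalizing u with
  | zero =>
    refine (card_le_card (t := {u}) fun v hv => ?_).trans (by simp)
    obtain ⟨p, hp⟩ := (mem_filter.1 hv).2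
    rw [mem_singleton]
    exact (SimpleGraph.Walk.eq_of_length_eq_zero (Nat.le_zero.1 hp)).symm
  | succ n ih =>
    have hsub : ({v | ∃ p : G.Walk u v, p.length ≤ n + 1} : Finset V) ⊆ {u} ∪
        (G.neighborFinset u).biUnion fun w => {v | ∃ p : G.Walk w v, p.length ≤ n} := by
      intro v hv
      obtain ⟨p, hp⟩ := (mem_filter.1 hv).2
      rw [mem_union, mem_singleton, mem_biUnion]
      cases p with
      | nil => exact Or.inl rfl
      | @cons _ w _ hw q =>
        rw [SimpleGraph.Walk.length_cons] at hp
        exact Or.inr ⟨w, by simpa using hw, mem_filter.2 ⟨mem_univ _, q, by omega⟩⟩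
    have h1 : #((G.neighborFinset u).biUnion fun w => {v | ∃ p : G.Walk w v, p.length ≤ n}) ≤
        3 * 4 ^ n :=
      (card_biUnion_le_card_mul _ _ _ fun w _ => ih w).trans
        (by gcongr; rw [G.card_neighborFinset_eq_degree]; exact hd u)
    have h2 : 1 ≤ 4 ^ n := Nat.one_le_pow _ _ (by norm_num)
    have h3 := (card_le_card hsub).trans (card_union_le _ _)
    rw [card_singleton] at h3
    rw [pow_succ]
    have h4 := h3.trans (by omega : _ ≤ 4 ^ n * 4)
    convert h4

theorem SimpleGraph.Connected.lpFeasible_min_dist {V : Type*} {G : SimpleGraph V}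
    (hG : G.Connected) {D : ℝ} (hD : 0 < D) :
    LPFeasible fun u v => min 1 ((G.dist u v : ℝ) / D) where
  triangle u v w := by
    have h1 : (G.dist u w : ℝ) / D ≤ G.dist u v / D + G.dist v w / D := by
      rw [← add_div]
      gcongr
      exact_mod_cast hG.dist_triangle
    have h2 : 0 ≤ (G.dist u v : ℝ) / D := by positivity
    have h3 : 0 ≤ (G.dist v w : ℝ) / D := by positivity
    rcases min_cases 1 ((G.dist u v : ℝ) / D) with h | h <;>
    rcases min_cases 1 ((G.dist v w : ℝ) / D) with h' | h' <;>
    rcases min_cases 1 ((G.dist u w : ℝ) / D) with h'' | h'' <;> linarith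
  symm u v := by simp [G.dist_comm]
  self u := by simp
  mem_Icc u v := ⟨by positivity, min_le_left _ _⟩

/-! ### Bounds on the LP value -/

namespace BipartiteCC

theorem ofGraph_isAsymmetric {L R : Type*} (G : SimpleGraph (L ⊕ R)) {α : ℝ} (hα : α ≤ 1) :
    (ofGraph G α).IsAsymmetric α := by
  refine ⟨1, one_pos, fun l r h => ?_, fun l r h => ?_⟩
  · have h' : G.Adj (Sum.inl l) (Sum.inr r) := h
    simp [ofGraph, h', hα]
  · have h' : ¬ G.Adj (Sum.inl l) (Sum.inr r) := h
    simp [ofGraph, h']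

variable {L R : Type*} [Fintype L] [Fintype R]

open Classical in
theorem ofGraph_lpCost (G : SimpleGraph (L ⊕ R)) (α : ℝ) (x : L ⊕ R → L ⊕ R → ℝ) :
    (ofGraph G α).lpCost x = ∑ l : L, ∑ r : R, if G.Adj (Sum.inl l) (Sum.inr r)
      then x (Sum.inl l) (Sum.inr r) else α * (1 - x (Sum.inl l) (Sum.inr r)) := by
  refine Finset.sum_congr rfl fun l _ => Finset.sum_congr rfl fun r _ => ?_
  by_cases h : G.Adj (Sum.inl l) (Sum.inr r) <;> simp [ofGraph, h]

open Classical in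
theorem ofGraph_clusterCost (G : SimpleGraph (L ⊕ R)) (α : ℝ) (s : Setoid (L ⊕ R)) :
    (ofGraph G α).clusterCost s = ∑ l : L, ∑ r : R, if G.Adj (Sum.inl l) (Sum.inr r)
      then (if s (Sum.inl l) (Sum.inr r) then 0 else 1)
      else (if s (Sum.inl l) (Sum.inr r) then α else 0) := by
  refine Finset.sum_congr rfl fun l _ => Finset.sum_congr rfl fun r _ => ?_
  by_cases h : G.Adj (Sum.inl l) (Sum.inr r) <;> simp [ofGraph, h]

open Classical in
theorem le_ofGraph_lpCost (G : SimpleGraph (L ⊕ R)) {α : ℝ} (hα : 0 ≤ α)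
    {x : L ⊕ R → L ⊕ R → ℝ} (hx : LPFeasible x) (l : L) (r : R) :
    (if G.Adj (Sum.inl l) (Sum.inr r) then x (Sum.inl l) (Sum.inr r)
      else α * (1 - x (Sum.inl l) (Sum.inr r))) ≤ (ofGraph G α).lpCost x := by
  rw [ofGraph_lpCost]
  have hnn : ∀ l r, 0 ≤ (if G.Adj (Sum.inl l) (Sum.inr r) then x (Sum.inl l) (Sum.inr r)
      else α * (1 - x (Sum.inl l) (Sum.inr r))) := by
    intro l r
    obtain ⟨h0, h1⟩ := hx.mem_Icc (Sum.inl l) (Sum.inr r)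
    split_ifs
    · exact h0
    · exact mul_nonneg hα (by linarith)
  refine le_trans ?_ (Finset.single_le_sum (fun l _ => Finset.sum_nonneg fun r _ => hnn l r)
    (Finset.mem_univ l))
  exact Finset.single_le_sum (f := fun r => if G.Adj (Sum.inl l) (Sum.inr r) then
    x (Sum.inl l) (Sum.inr r) else α * (1 - x (Sum.inl l) (Sum.inr r))) (fun r _ => hnn l r)
    (Finset.mem_univ r)

theorem lpFeasible_zero {V : Type*} : LPFeasible fun _ _ : V => (0 : ℝ) := by
  constructor <;> simp

/-- The infimum needs a uniform bound. A solution of cost C has x ≤ C on every edge, hence x ≤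
C·length along a path joining a non-adjacent pair, while that pair itself costs α(1 − x) ≤ C. -/
theorem ofGraph_lpValue_pos {G : SimpleGraph (L ⊕ R)} (hG : G.Connected)
    (hbip : G ≤ completeBipartiteGraph L R) {α : ℝ} (hα : 0 < α) {l : L} {r : R}
    (hlr : ¬ G.Adj (Sum.inl l) (Sum.inr r)) : 0 < (ofGraph G α).lpValue := by
  obtain ⟨p⟩ := hG.preconnected (Sum.inl l) (Sum.inr r)
  refine lt_of_lt_of_le (b := α / (1 + α * p.length)) (by positivity) ?_
  refine le_csInf ⟨_, _, lpFeasible_zero, rfl⟩ ?_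
  rintro _ ⟨x, hx, rfl⟩
  have hx : LPFeasible x := hx
  set C := (ofGraph G α).lpCost x with hC
  have hle := fun l r => le_ofGraph_lpCost G hα.le hx l r
  rw [← hC] at hle
  have hedge : ∀ u v, G.Adj u v → x u v ≤ C := by
    rintro (a | a) (b | b) hab
    · simpa using hbip hab
    · simpa [hab] using hle a b
    · rw [hx.symm]
      simpa [hab.symm] using hle b a
    · simpa using hbip hab
  have h1 := hx.le_length_mul hedge p
  have h2 := hle l r
  rw [if_neg hlr] at h2
  rw [div_le_iff₀ (by positivity)]
  nlinarith

open Finset in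
theorem ofGraph_lpValue_le {G : SimpleGraph (L ⊕ R)} (hG : G.Connected) [G.LocallyFinite]
    (hd : ∀ v, G.degree v ≤ 3) {α : ℝ} (hα : 0 ≤ α) {D : ℕ} (hD : 0 < D) :
    (ofGraph G α).lpValue ≤ Fintype.card L * (3 / D + α * 4 ^ D) := by
  classical
  have hD' : (0 : ℝ) < D := by exact_mod_cast hD
  have hfeas := hG.lpFeasible_min_dist hD'
  have hbdd : BddBelow ((ofGraph G α).lpCost '' {x | LPFeasible x}) := by
    refine ⟨0, ?_⟩
    rintro _ ⟨x, hx, rfl⟩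
    rw [ofGraph_lpCost]
    refine sum_nonneg fun l _ => sum_nonneg fun r _ => ?_
    obtain ⟨h0, h1⟩ := LPFeasible.mem_Icc hx (Sum.inl l) (Sum.inr r)
    split_ifs
    · exact h0
    · exact mul_nonneg hα (by linarith)
  refine (csInf_le hbdd ⟨_, hfeas, rfl⟩).trans ?_
  rw [ofGraph_lpCost, ← nsmul_eq_mul, ← card_univ, ← sum_const]
  refine sum_le_sum fun l _ => ?_
  let Q : R → Prop := fun r => ∃ p : G.Walk (Sum.inl l) (Sum.inr r), p.length ≤ D
  have hterm : ∀ r : R, (if G.Adj (Sum.inl l) (Sum.inr r)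
      then min 1 ((G.dist (Sum.inl l) (Sum.inr r) : ℝ) / D)
      else α * (1 - min 1 ((G.dist (Sum.inl l) (Sum.inr r) : ℝ) / D))) ≤
      (if G.Adj (Sum.inl l) (Sum.inr r) then 1 / (D : ℝ) else 0) + if Q r then α else 0 := by
    intro r
    have hQ : 0 ≤ if Q r then α else 0 := by split_ifs <;> simp [hα]
    by_cases h : G.Adj (Sum.inl l) (Sum.inr r)
    · simp only [h, if_true, SimpleGraph.dist_eq_one_iff_adj.2 h]
      push_cast
      exact (min_le_right _ _).trans (by linarith)
    · simp only [h, if_false, zero_add]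
      obtain ⟨p, hp⟩ := hG.exists_walk_length_eq_dist (Sum.inl l) (Sum.inr r)
      by_cases hq : Q r
      · rw [if_pos hq]
        have : 0 ≤ min 1 ((G.dist (Sum.inl l) (Sum.inr r) : ℝ) / D) := by positivity
        nlinarith
      · rw [if_neg hq, min_eq_left]
        · simp
        · rw [le_div_iff₀ hD', one_mul]
          by_contra! hlt
          exact hq ⟨p, by rw [hp]; exact_mod_cast hlt.le⟩
  refine (sum_le_sum fun r _ => hterm r).trans ?_
  rw [sum_add_distrib, ← sum_filter, ← sum_filter, sum_const, sum_const, nsmul_eq_mul, nsmul_eq_mul]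
  have hA : #{r | G.Adj (Sum.inl l) (Sum.inr r)} ≤ 3 := by
    refine le_trans ?_ (hd (Sum.inl l))
    rw [← G.card_neighborFinset_eq_degree]
    refine card_le_card_of_injOn Sum.inr (fun r hr => ?_) Sum.inr_injective.injOn
    simpa using hr
  have hB : #{r | Q r} ≤ 4 ^ D := by
    refine le_trans ?_ (G.card_walk_length_le hd D (Sum.inl l))
    refine card_le_card_of_injOn Sum.inr (fun r hr => ?_) Sum.inr_injective.injOn
    simpa [Q] using hr
  have hA' : (#{r | G.Adj (Sum.inl l) (Sum.inr r)} : ℝ) ≤ 3 := by exact_mod_cast hA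
  have hB' : (#{r | Q r} : ℝ) ≤ 4 ^ D := by exact_mod_cast hB
  calc _ ≤ 3 * (1 / (D : ℝ)) + 4 ^ D * α := by gcongr
    _ = _ := by ring

end BipartiteCC

/-! ### Lower bound on the cost of a clustering -/

namespace BipartiteCC

open Classical Finset in
/-- Ordered adjacent pairs that are separated by the clustering. -/
theorem card_separated_le_two_mul_clusterCost {L R : Type*} [Fintype L] [Fintype R]
    {G : SimpleGraph (L ⊕ R)} (hG : G ≤ completeBipartiteGraph L R) {α : ℝ} (hα : 0 ≤ α)
    (s : Setoid (L ⊕ R)) :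
    (#{p : (L ⊕ R) × (L ⊕ R) | G.Adj p.1 p.2 ∧ ¬ s p.1 p.2} : ℝ) ≤
      2 * (ofGraph G α).clusterCost s := by
  rw [ofGraph_clusterCost]
  let E : Finset ((L ⊕ R) × (L ⊕ R)) := {p | G.Adj p.1 p.2 ∧ ¬ s p.1 p.2}
  let E₁ : Finset (L × R) :=
    {p | G.Adj (Sum.inl p.1) (Sum.inr p.2) ∧ ¬ s (Sum.inl p.1) (Sum.inr p.2)}
  have hE : #E ≤ 2 * #E₁ := by
    have hsub : E ⊆ E₁.image (fun p => (Sum.inl p.1, Sum.inr p.2)) ∪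
        E₁.image (fun p => (Sum.inr p.2, Sum.inl p.1)) := by
      rintro ⟨a | a, b | b⟩ hp <;> simp only [E, mem_filter, mem_univ, true_and] at hp
      · simpa using hG hp.1
      · exact mem_union_left _ (mem_image.2 ⟨(a, b), by simpa [E₁] using hp, rfl⟩)
      · exact mem_union_right _ (mem_image.2 ⟨(b, a), by
          simpa [E₁, G.adj_comm, s.comm'] using hp, rfl⟩)
      · simpa using hG hp.1
    have := (card_le_card hsub).trans (card_union_le _ _)
    have h1 := card_image_le (s := E₁)
      (f := fun p => ((Sum.inl p.1, Sum.inr p.2) : (L ⊕ R) × (L ⊕ R)))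
    have h2 := card_image_le (s := E₁)
      (f := fun p => ((Sum.inr p.2, Sum.inl p.1) : (L ⊕ R) × (L ⊕ R)))
    omega
  have hE' : (#E : ℝ) ≤ 2 * #E₁ := by exact_mod_cast hE
  have hcut : (#E₁ : ℝ) ≤ ∑ l : L, ∑ r : R, if G.Adj (Sum.inl l) (Sum.inr r)
      then (if s (Sum.inl l) (Sum.inr r) then 0 else 1)
      else (if s (Sum.inl l) (Sum.inr r) then α else 0) := by
    rw [← Fintype.sum_prod_type', card_filter]
    push_cast
    refine sum_le_sum fun p _ => ?_
    split_ifs <;> simp_all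
  linarith

-- All left-right pairs inside the cluster of u are negative except for at most three per left
-- vertex.
open Classical Finset in
theorem negative_weight_le_clusterCost {L R : Type*} [Fintype L] [Fintype R]
    {G : SimpleGraph (L ⊕ R)} [G.LocallyFinite] (hd : ∀ v, G.degree v ≤ 3) {α : ℝ} (hα0 : 0 ≤ α)
    (s : Setoid (L ⊕ R)) (u : L ⊕ R) :
    α * (#{l | s u (Sum.inl l)} * #{r | s u (Sum.inr r)} - 3 * Fintype.card L) ≤
      (ofGraph G α).clusterCost s := by
  rw [ofGraph_clusterCost]
  set A : Finset L := {l | s u (Sum.inl l)} with hA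
  set B : Finset R := {r | s u (Sum.inr r)} with hB
  have hrow : ∀ l : L, (if l ∈ A then α * #B else 0) - α * 3 ≤
      ∑ r : R, if G.Adj (Sum.inl l) (Sum.inr r)
        then (if s (Sum.inl l) (Sum.inr r) then (0 : ℝ) else 1)
        else (if s (Sum.inl l) (Sum.inr r) then α else 0) := by
    intro l
    have hdeg : #{r | G.Adj (Sum.inl l) (Sum.inr r)} ≤ 3 := by
      refine le_trans ?_ (hd (Sum.inl l))
      rw [← G.card_neighborFinset_eq_degree]
      refine card_le_card_of_injOn Sum.inr (fun r hr => ?_) Sum.inr_injective.injOn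
      simpa using hr
    have hdeg' : (#{r | G.Adj (Sum.inl l) (Sum.inr r)} : ℝ) ≤ 3 := by exact_mod_cast hdeg
    have hterm : ∀ r : R, (if l ∈ A ∧ r ∈ B then α else 0) -
        (if G.Adj (Sum.inl l) (Sum.inr r) then α else 0) ≤
        if G.Adj (Sum.inl l) (Sum.inr r)
        then (if s (Sum.inl l) (Sum.inr r) then (0 : ℝ) else 1)
        else (if s (Sum.inl l) (Sum.inr r) then α else 0) := by
      intro r
      have hs : l ∈ A ∧ r ∈ B → s (Sum.inl l) (Sum.inr r) := by
        simp only [hA, hB, mem_filter, mem_univ, true_and]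
        exact fun h => s.trans' (s.symm' h.1) h.2
      by_cases h1 : l ∈ A ∧ r ∈ B
      · rw [if_pos h1]
        simp only [hs h1, if_true]
        split_ifs <;> linarith
      · rw [if_neg h1]
        split_ifs <;> linarith
    refine le_trans ?_ (sum_le_sum fun r _ => hterm r)
    rw [sum_sub_distrib, ← sum_filter (p := fun r => G.Adj (Sum.inl l) (Sum.inr r)), sum_const,
      nsmul_eq_mul]
    have h5 : (if l ∈ A then α * #B else 0) = ∑ r : R, if l ∈ A ∧ r ∈ B then α else 0 := by
      by_cases hl : l ∈ A <;> simp [hl, mul_comm]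
    rw [h5]
    nlinarith
  refine le_trans (le_of_eq ?_) (sum_le_sum fun l _ => hrow l)
  rw [sum_sub_distrib, sum_const, nsmul_eq_mul, card_univ, sum_ite_mem, univ_inter, sum_const,
    nsmul_eq_mul]
  ring

open Finset in
theorem le_ofGraph_clusterCost {W : Type*} [Fintype W] {G : SimpleGraph (W ⊕ W)} {h α : ℝ}
    (hG : IsCubicBipartiteExpander G h) (hh : 0 ≤ h) (hh' : h ≤ 1 / 2) (hm : 24 ≤ Fintype.card W)
    (hα : 1 ≤ α * Fintype.card W) (s : Setoid (W ⊕ W)) :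
    h / 4 * Fintype.card W ≤ (ofGraph G α).clusterCost s := by
  classical
  set m := Fintype.card W with hm_def
  have hm' : (24 : ℝ) ≤ m := by exact_mod_cast hm
  have hα0 : 0 ≤ α := by
    by_contra! hneg
    nlinarith
  let E : Finset ((W ⊕ W) × (W ⊕ W)) := {p | G.Adj p.1 p.2 ∧ ¬ s p.1 p.2}
  have hE : (#E : ℝ) ≤ 2 * (ofGraph G α).clusterCost s := by
    convert card_separated_le_two_mul_clusterCost hG.bipartite hα0 s
  -- E counts each cut edge in both orders, so h/2 here yields the h/4 of the conclusion.
  by_cases hcut' : h / 2 * m ≤ #E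
  · linarith
  push Not at hcut'
  have hclosed : ∀ S : Finset (W ⊕ W), (∀ u v, s u v → (u ∈ S ↔ v ∈ S)) →
      G.interedges S Sᶜ ⊆ {p ∈ E | p.1 ∈ S} := by
    rintro S hS ⟨u, v⟩ huv
    rw [SimpleGraph.mem_interedges_iff, mem_compl] at huv
    simp only [E, mem_filter, mem_univ, true_and]
    exact ⟨⟨huv.2.2, fun hs => huv.2.1 ((hS u v hs).1 huv.1)⟩, huv.1⟩
  have hexp : ∀ S : Finset (W ⊕ W), (∀ u v, s u v → (u ∈ S ↔ v ∈ S)) → 2 * #S ≤ 2 * m →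
      h * #S ≤ #{p ∈ E | p.1 ∈ S} := by
    intro S hS hcard
    have h1 := hG.expansion S (by rw [Fintype.card_sum]; omega)
    refine h1.trans ?_
    have h2 := card_le_card (hclosed S hS)
    refine le_trans (le_of_eq ?_) (Nat.cast_le.2 h2)
    congr!
  let cls : W ⊕ W → Finset (W ⊕ W) := fun u => {v | s u v}
  have hcls : ∀ u v w, s v w → (v ∈ cls u ↔ w ∈ cls u) := by
    intro u v w hvw
    simp only [cls, mem_filter, mem_univ, true_and]
    exact ⟨fun h => s.trans' h hvw, fun h => s.trans' h (s.symm' hvw)⟩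
  -- Without a giant cluster, summing expansion over all clusters gives |E| ≥ 2hm, more than the
  -- remaining case allows.
  obtain ⟨u, hu⟩ : ∃ u, m < #(cls u) := by
    by_contra! hsmall
    have key : h * (2 * m) ≤ #E := by
      rw [card_eq_sum_card_fiberwise (f := fun p : (W ⊕ W) × (W ⊕ W) => (Quotient.mk s p.1))
        (t := univ) (fun _ _ => by simp)]
      have h1 : (2 * m : ℝ) = ((∑ q : Quotient s, #{u : W ⊕ W | Quotient.mk s u = q} : ℕ) : ℝ) := by
        rw [← card_eq_sum_card_fiberwise (f := fun u : W ⊕ W => (Quotient.mk s u))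
          (t := univ) (fun _ _ => by simp), card_univ, Fintype.card_sum]
        push_cast
        ring
      rw [h1]
      push_cast
      rw [mul_sum]
      refine sum_le_sum fun q _ => ?_
      induction q using Quotient.inductionOn with
      | h u =>
        have h2 : ({v : W ⊕ W | Quotient.mk s v = Quotient.mk s u} : Finset _) = cls u := by
          ext v
          simp only [cls, mem_filter, mem_univ, true_and]
          rw [Quotient.eq]
          exact s.comm'
        have h3 : {p ∈ E | Quotient.mk s p.1 = Quotient.mk s u} = {p ∈ E | p.1 ∈ cls u} := by
          refine filter_congr fun p _ => ?_
          simp only [← h2, mem_filter, mem_univ, true_and]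
        rw [h2, h3]
        exact hexp _ (hcls u) (by have := hsmall u; omega)
    nlinarith
  have hcompl : h * #(cls u)ᶜ ≤ #E := by
    refine (hexp (cls u)ᶜ (fun v w hvw => ?_) ?_).trans ?_
    · rw [mem_compl, mem_compl, hcls u v w hvw]
    · rw [card_compl, Fintype.card_sum]; omega
    · exact_mod_cast card_le_card (filter_subset _ _)
  let A : Finset W := {l | s u (Sum.inl l)}
  let B : Finset W := {r | s u (Sum.inr r)}
  have hAB : #A + #B + #(cls u)ᶜ = 2 * m := by
    have : A.disjSum B = cls u := by
      ext (x | x) <;> simp [A, B, cls]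
    rw [← card_disjSum, this, card_add_card_compl, Fintype.card_sum]
    omega
  have hAm : #A ≤ m := card_le_univ A
  have hBm : #B ≤ m := card_le_univ B
  have hABr : (#A + #B + #(cls u)ᶜ : ℝ) = 2 * m := by exact_mod_cast hAB
  have hAmr : (#A : ℝ) ≤ m := by exact_mod_cast hAm
  have hBmr : (#B : ℝ) ≤ m := by exact_mod_cast hBm
  have hc : (#(cls u)ᶜ : ℝ) ≤ m / 2 := by
    by_contra! hlt
    nlinarith
  have hneg : α * (#A * #B - 3 * m) ≤ (ofGraph G α).clusterCost s := by
    convert negative_weight_le_clusterCost (fun v => (hG.regular v).le) hα0 s u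
  refine le_trans ?_ hneg
  have hAlow : (m : ℝ) / 2 ≤ #A := by linarith
  have hBlow : (m : ℝ) / 2 ≤ #B := by linarith
  have h1 : (m : ℝ) / 2 * (m / 2) ≤ #A * #B := by gcongr
  -- From m²/4 − 3m ≥ m²/8, which is exactly m ≥ 24.
  have h2 : (m : ℝ) * m / 8 ≤ #A * #B - 3 * m := by nlinarith
  calc h / 4 * m ≤ 1 / 8 * m := mul_le_mul_of_nonneg_right (by linarith) (by linarith)
    _ ≤ α * m / 8 * m := by gcongr
    _ = α * (m * m / 8) := by ring
    _ ≤ _ := by gcongr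

end BipartiteCC

/-! ### Choice of parameters and conclusion -/

theorem exists_depth {α : ℝ} (h0 : 0 < α) (h1 : α < 1) :
    ∃ D : ℕ, 0 < D ∧ Real.log (1 / α) * (3 / D + α * 4 ^ D) ≤ 28 := by
  rw [one_div, Real.log_inv]
  set y := -Real.log α with hy
  have hy0 : 0 < y := by rw [hy]; linarith [Real.log_neg h0 h1]
  have hα : α = Real.exp (-y) := by rw [hy, neg_neg, Real.exp_log h0]
  rcases le_or_gt y 4 with h4 | h4
  -- The constant 28 = 4·(3 + 4) arises here; large y only needs 24 + 2.
  · refine ⟨1, one_pos, ?_⟩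
    norm_num
    nlinarith
  -- Since 4 ≤ e², this depth gives 4^D ≤ α^(-1/2), so α·4^D ≤ α^(1/2) still beats the logarithm.
  · refine ⟨⌊y / 4⌋₊, Nat.floor_pos.2 (by linarith), ?_⟩
    set D := ⌊y / 4⌋₊ with hD
    have hle : (D : ℝ) ≤ y / 4 := Nat.floor_le (by linarith)
    have hgt : y / 4 < D + 1 := Nat.lt_floor_add_one _
    have hDpos : 1 ≤ D := Nat.floor_pos.2 (by linarith)
    have hDpos' : (1 : ℝ) ≤ D := by exact_mod_cast hDpos
    have h5 : y * (3 / D) ≤ 24 := by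
      rw [mul_div_assoc', div_le_iff₀ (by linarith)]
      linarith
    have h6 : (4 : ℝ) ^ D ≤ Real.exp (y / 2) := by
      have h7 : (4 : ℝ) ≤ Real.exp 2 := by
        have := Real.exp_one_gt_d9
        rw [show (2 : ℝ) = 1 + 1 by norm_num, Real.exp_add]
        nlinarith
      calc (4 : ℝ) ^ D ≤ Real.exp 2 ^ D := by gcongr
        _ = Real.exp (D * 2) := by rw [← Real.exp_nat_mul]
        _ ≤ _ := Real.exp_le_exp.2 (by linarith)
    have h8 : y * (α * 4 ^ D) ≤ 2 := by
      have h9 : α * 4 ^ D ≤ Real.exp (-(y / 2)) := by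
        calc α * 4 ^ D ≤ Real.exp (-y) * Real.exp (y / 2) := by rw [hα]; gcongr
          _ = _ := by rw [← Real.exp_add]; ring_nf
      have h10 : y / 2 * Real.exp (-(y / 2)) ≤ 1 := by
        rw [Real.exp_neg, ← div_eq_mul_inv, div_le_one (Real.exp_pos _)]
        linarith [Real.add_one_le_exp (y / 2)]
      nlinarith
    rw [mul_add]
    linarith

/-- With α = e^(-y), the bound e^y ≥ 1 + y + y²/2 gives αy ≤ 1 and αy² ≤ 2. The first conclusion
absorbs rounding of the graph size; the second ensures α·m ≥ 1. -/
theorem sq_mul_sq_log_bounds {α : ℝ} (h0 : 0 < α) (h1 : α < 1) :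
    1 ≤ (α ^ 2 * Real.log α ^ 2)⁻¹ ∧ 1 / 4 ≤ α * (α ^ 2 * Real.log α ^ 2)⁻¹ := by
  set y := -Real.log α with hy
  have hlog : Real.log α ^ 2 = y ^ 2 := by rw [hy, neg_sq]
  have hy0 : 0 < y := by rw [hy]; linarith [Real.log_neg h0 h1]
  have hα : α * Real.exp y = 1 := by
    rw [hy, Real.exp_neg, Real.exp_log h0, mul_inv_cancel₀ h0.ne']
  have h2 := Real.quadratic_le_exp_of_nonneg hy0.le
  rw [hlog]
  have h3 : α * y ≤ 1 := by nlinarith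
  have h4 : α * y ^ 2 ≤ 2 := by nlinarith
  constructor
  · refine (one_le_inv₀ (by positivity)).2 ?_
    rw [← mul_pow]
    exact pow_le_one₀ (by positivity) h3
  · rw [← div_eq_mul_inv, div_le_div_iff₀ (by norm_num) (by positivity)]
    nlinarith

theorem theorem4 :
    ∃ c h a b : ℝ, 0 < c ∧ 0 < h ∧ 0 < a ∧ 0 < b ∧
      ∀ α : ℝ, 0 < α → α < 1 →
        ∃ (m : ℕ) (G : SimpleGraph (Fin m ⊕ Fin m)),
          a * (α ^ 2 * Real.log α ^ 2)⁻¹ ≤ (2 * m : ℝ) ∧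
          (2 * m : ℝ) ≤ b * (α ^ 2 * Real.log α ^ 2)⁻¹ ∧
          IsCubicBipartiteExpander G h ∧
          (BipartiteCC.ofGraph G α).IsAsymmetric α ∧
          0 < (BipartiteCC.ofGraph G α).lpValue ∧
          c * Real.log (1 / α) ≤ (BipartiteCC.ofGraph G α).integralityGap := by
  classical
  -- Here c is h/4 from OPT divided by 28 from LP; n = 10k with 5X ≤ k ≤ 6X gives 50 and 60.
  refine ⟨1 / 6010 / 4 / 28, 1 / 6010, 50, 60, by norm_num, by norm_num, by norm_num, by norm_num,
    fun α h0 h1 => ?_⟩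
  obtain ⟨hX1, hX2⟩ := sq_mul_sq_log_bounds h0 h1
  set X := (α ^ 2 * Real.log α ^ 2)⁻¹
  obtain ⟨k, hk1, hk2⟩ : ∃ k : ℕ, 5 * X ≤ k ∧ (k : ℝ) ≤ 6 * X :=
    ⟨⌈5 * X⌉₊, Nat.le_ceil _, by linarith [Nat.ceil_lt_add_one (by linarith : 0 ≤ 5 * X)]⟩
  have hk5 : 5 ≤ k := by exact_mod_cast (by linarith : (5 : ℝ) ≤ k)
  obtain ⟨G, hG⟩ := exists_isCubicBipartiteExpander (rfl : k * 5 = k * 5)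
  have hne : Nonempty (Fin (k * 5) ⊕ Fin (k * 5)) := ⟨Sum.inl ⟨0, by omega⟩⟩
  have hconn := hG.expansion.connected (by norm_num)
  have hpos : 0 < (BipartiteCC.ofGraph G α).lpValue := by
    let l : Fin (k * 5) := ⟨0, by omega⟩
    obtain ⟨r, hr⟩ : ∃ r, ¬ G.Adj (Sum.inl l) (Sum.inr r) := by
      by_contra! hall
      have h2 := hG.regular (Sum.inl l)
      rw [← G.card_neighborFinset_eq_degree] at h2
      have h3 : k * 5 ≤ 3 := by
        calc k * 5 = (Finset.univ : Finset (Fin (k * 5))).card := by simp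
          _ ≤ (G.neighborFinset (Sum.inl l)).card := ?_
          _ = 3 := h2
        exact Finset.card_le_card_of_injOn Sum.inr (fun r _ => by simpa using hall r)
          Sum.inr_injective.injOn
      omega
    exact BipartiteCC.ofGraph_lpValue_pos hconn hG.bipartite h0 hr
  refine ⟨k * 5, G, by push_cast; linarith, by push_cast; linarith, hG,
    BipartiteCC.ofGraph_isAsymmetric G h1.le, hpos, ?_⟩
  obtain ⟨D, hD, hDle⟩ := exists_depth h0 h1
  have hLP := BipartiteCC.ofGraph_lpValue_le hconn (fun v => (hG.regular v).le) h0.le hD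
  have hOPT : (1 / 6010) / 4 * ((k * 5 : ℕ) : ℝ) ≤ (BipartiteCC.ofGraph G α).optValue := by
    refine le_csInf (Set.range_nonempty _) ?_
    rintro _ ⟨s, rfl⟩
    have := BipartiteCC.le_ofGraph_clusterCost (α := α) hG (by norm_num) (by norm_num)
      (by rw [Fintype.card_fin]; omega)
      (by rw [Fintype.card_fin]; push_cast; nlinarith) s
    rwa [Fintype.card_fin] at this
  rw [Fintype.card_fin] at hLP
  have hlog : 0 < Real.log (1 / α) := Real.log_pos (by rw [lt_div_iff₀ h0]; linarith)
  rw [BipartiteCC.integralityGap, le_div_iff₀ hpos]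
  refine le_trans ?_ hOPT
  have hLP' : Real.log (1 / α) * (BipartiteCC.ofGraph G α).lpValue ≤ ((k * 5 : ℕ) : ℝ) * 28 := by
    calc _ ≤ Real.log (1 / α) * (((k * 5 : ℕ) : ℝ) * (3 / D + α * 4 ^ D)) := by gcongr
      _ = ((k * 5 : ℕ) : ℝ) * (Real.log (1 / α) * (3 / D + α * 4 ^ D)) := by ring
      _ ≤ _ := by gcongr
  linarith
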